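/- Let $F$ be a field of characteristic zero and let $Q$ be a finite, non-empty acyclic quiver, i.e. $Q$ has finitely many (and at least one) vertices, finitely many arrows, and no oriented cycle (no path of length $\ge 1$ starts and ends at the same vertex). Then the lengths of the paths in $Q$ (vertices being counted as paths of length $0$) have a maximum; write it as $m-1$ with $m\ge 1$. Let $FQ$ be the path algebra: the $F$-vector space with basis all paths of $Q$, including the lazy path $e_v$ of length $0$ at each vertex $v$, where the product of two paths $p$ and $q$ is their concatenation $pq$ if $p$ ends where $q$ starts, and zero otherwise. Let $F\langle X\rangle$ be the free associative $F$-algebra in countably many variables $x_1,x_2,\dots$, and let $\mathrm{Id}(FQ)\subseteq F\langle X\rangle$ be the set of all $f$ that vanish under every substitution of elements of $FQ$ for the variables. Then $$\mathrm{Id}(FQ)=\big\langle [x_1,x_2][x_3,x_4]\cdots[x_{2m-1},x_{2m}]\big\rangle_T ,$$ where $[a,b]=ab-ba$ and $\langle Y\rangle_T$ denotes the T-ideal generated by $Y$, i.e. the smallest two-sided ideal of $F\langle X\rangle$ that contains $Y$ and is stable under all $F$-algebra endomorphisms of $F\langle X\rangle$. -/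

import Mathlib

namespace QuiverPI

universe u v w

/-! ### Quivers and paths -/

section Quivers

variable (V : Type u) [Quiver.{v} V]

/-- A path of the quiver `V` together with its starting and its terminal vertex.
The lazy path at `a` is `⟨a, a, Quiver.Path.nil⟩`. -/
structure QPath where
  source : V
  target : V
  path : Quiver.Path source target

/-- A quiver is acyclic if it contains no oriented cycle: the only paths that start and end at
the same vertex are the lazy ones. -/
def IsAcyclic : Prop :=
  ∀ (a : V) (p : Quiver.Path a a), p.length = 0

/-- The set of lengths of all paths of the quiver (lazy paths have length `0`). -/
def pathLengths : Set ℕ :=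
  {n | ∃ p : QPath V, p.path.length = n}

end Quivers

/-! ### The path algebra -/

/-- The underlying vector space of the path algebra: the free `F`-module on the set of all paths. -/
def PathAlgebra (F : Type w) (V : Type u) [Quiver.{v} V] [Field F] : Type (max u v w) :=
  QPath V →₀ F

namespace PathAlgebra

variable (F : Type w) (V : Type u) [Quiver.{v} V] [Field F]

noncomputable instance : AddCommGroup (PathAlgebra F V) :=
  inferInstanceAs (AddCommGroup (QPath V →₀ F))

noncomputable instance : Module F (PathAlgebra F V) :=
  inferInstanceAs (Module F (QPath V →₀ F))

variable {V}

/-- The standard basis vector attached to a path. -/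
noncomputable def ofPath (p : QPath V) : PathAlgebra F V :=
  Finsupp.single p 1

variable (V) in
/-- The standard basis of the path algebra: the set of all paths. -/
noncomputable def basis : Module.Basis (QPath V) F (PathAlgebra F V) :=
  Module.Basis.ofRepr (LinearEquiv.refl F (QPath V →₀ F))

theorem basis_apply (p : QPath V) : basis F V p = ofPath F p :=
  rfl

variable {F}

theorem hom_ext {M : Type*} [AddCommGroup M] [Module F M] {f g : PathAlgebra F V →ₗ[F] M}
    (h : ∀ p, f (ofPath F p) = g (ofPath F p)) : f = g :=
  (basis F V).ext h

variable (F)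

open Classical in
/-- The product of two paths: their concatenation (first `p`, then `q`) if `p` ends where `q`
starts, and zero otherwise. -/
noncomputable def pathMul (p q : QPath V) : PathAlgebra F V :=
  if h : q.source = p.target then
    ofPath F ⟨p.source, q.target, p.path.comp (q.path.cast h rfl)⟩
  else 0

variable (V)

/-- The multiplication, as the bilinear extension of the product of paths. -/
noncomputable def mulLin : PathAlgebra F V →ₗ[F] PathAlgebra F V →ₗ[F] PathAlgebra F V :=
  (basis F V).constr F fun p => (basis F V).constr F fun q => pathMul F p q

variable {V}

theorem mulLin_ofPath (p q : QPath V) :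
    mulLin F V (ofPath F p) (ofPath F q) = pathMul F p q := by
  rw [← basis_apply, ← basis_apply, mulLin, Module.Basis.constr_basis, Module.Basis.constr_basis]

theorem pathMul_comp {a b c : V} (p : Quiver.Path a b) (q : Quiver.Path b c) :
    pathMul F ⟨a, b, p⟩ ⟨b, c, q⟩ = ofPath F ⟨a, c, p.comp q⟩ := by
  simp [pathMul]

theorem pathMul_of_ne {p q : QPath V} (h : q.source ≠ p.target) : pathMul F p q = 0 := by
  simp [pathMul, h]

theorem mulLin_assoc (x y z : PathAlgebra F V) :
    mulLin F V (mulLin F V x y) z = mulLin F V x (mulLin F V y z) := by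
  have h : ∀ p q r : QPath V, mulLin F V (pathMul F p q) (ofPath F r) =
      mulLin F V (ofPath F p) (pathMul F q r) := by
    rintro ⟨a, b, p⟩ ⟨b', c, q⟩ ⟨c', d, r⟩
    by_cases h1 : b' = b
    · subst h1
      rw [pathMul_comp, mulLin_ofPath]
      by_cases h2 : c' = c
      · subst h2
        rw [pathMul_comp, pathMul_comp, mulLin_ofPath, pathMul_comp, Quiver.Path.comp_assoc]
      · rw [pathMul_of_ne F (by exact h2), pathMul_of_ne F (by exact h2), map_zero]
    · rw [pathMul_of_ne F (by exact h1), map_zero, LinearMap.zero_apply]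
      by_cases h2 : c' = c
      · subst h2
        rw [pathMul_comp, mulLin_ofPath, pathMul_of_ne F (by exact h1)]
      · rw [pathMul_of_ne F (by exact h2), map_zero]
  have hz : ∀ p q : QPath V, mulLin F V (pathMul F p q) =
      (mulLin F V (ofPath F p)).comp (mulLin F V (ofPath F q)) := fun p q =>
    hom_ext fun r => by rw [LinearMap.comp_apply, mulLin_ofPath, h]
  have hy : ∀ p : QPath V, ((mulLin F V).comp (mulLin F V (ofPath F p))).flip z =
      (mulLin F V (ofPath F p)).comp ((mulLin F V).flip z) := fun p =>
    hom_ext fun q => by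
      simp only [LinearMap.flip_apply, LinearMap.comp_apply, mulLin_ofPath, hz]
  have hx : ((mulLin F V).flip z).comp ((mulLin F V).flip y) =
      (mulLin F V).flip (mulLin F V y z) :=
    hom_ext fun p => by
      simpa only [LinearMap.flip_apply, LinearMap.comp_apply] using
        LinearMap.congr_fun (hy p) y
  simpa only [LinearMap.flip_apply, LinearMap.comp_apply] using LinearMap.congr_fun hx x

variable [Fintype V]

/-- The unit of the path algebra: the sum of all lazy paths. -/
noncomputable def unit : PathAlgebra F V :=
  ∑ a : V, ofPath F ⟨a, a, Quiver.Path.nil⟩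

theorem mulLin_unit_left (x : PathAlgebra F V) : mulLin F V (unit F) x = x := by
  have h : mulLin F V (unit F) = LinearMap.id := hom_ext fun ⟨a, b, p⟩ => by
    rw [unit, map_sum, LinearMap.sum_apply, Finset.sum_eq_single a]
    · rw [mulLin_ofPath, pathMul_comp, Quiver.Path.nil_comp, LinearMap.id_apply]
    · intro c _ hc
      rw [mulLin_ofPath, pathMul_of_ne F (by exact hc.symm)]
    · simp
  rw [h, LinearMap.id_apply]

theorem mulLin_unit_right (x : PathAlgebra F V) : mulLin F V x (unit F) = x := by
  have h : (mulLin F V).flip (unit F) = LinearMap.id := hom_ext fun ⟨a, b, p⟩ => by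
    rw [LinearMap.flip_apply, unit, map_sum, Finset.sum_eq_single b]
    · rw [mulLin_ofPath, pathMul_comp, Quiver.Path.comp_nil, LinearMap.id_apply]
    · intro c _ hc
      rw [mulLin_ofPath, pathMul_of_ne F (by exact hc)]
    · simp
  simpa using LinearMap.congr_fun h x

noncomputable instance : Ring (PathAlgebra F V) where
  __ := (inferInstance : AddCommGroup (PathAlgebra F V))
  mul x y := mulLin F V x y
  one := unit F
  left_distrib x y z := map_add (mulLin F V x) y z
  right_distrib x y z := LinearMap.map_add₂ (mulLin F V) x y z
  zero_mul x := LinearMap.map_zero₂ (mulLin F V) x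
  mul_zero x := map_zero (mulLin F V x)
  mul_assoc := mulLin_assoc F
  one_mul := mulLin_unit_left F
  mul_one := mulLin_unit_right F

noncomputable instance : Algebra F (PathAlgebra F V) :=
  Algebra.ofModule
    (fun c x y => LinearMap.map_smul₂ (mulLin F V) c x y)
    (fun c x y => map_smul (mulLin F V x) c y)

end PathAlgebra

/-! ### Polynomial identities -/

section Identities

variable (F : Type w) [Field F]

/-- The two-sided ideal of polynomial identities of an `F`-algebra `A`: the noncommutative
polynomials in countably many variables that vanish under every substitution of elements of `A`
for the variables. -/
noncomputable def identities (A : Type*) [Ring A] [Algebra F A] :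
    TwoSidedIdeal (FreeAlgebra F ℕ) :=
  TwoSidedIdeal.mk' {f | ∀ a : ℕ → A, FreeAlgebra.lift F a f = 0}
    (fun a => map_zero _)
    (fun {x y} hx hy a => by rw [map_add, hx a, hy a, add_zero])
    (fun {x} hx a => by rw [map_neg, hx a, neg_zero])
    (fun {x y} hy a => by rw [map_mul, hy a, mul_zero])
    (fun {x y} hx a => by rw [map_mul, hx a, zero_mul])

theorem mem_identities {A : Type*} [Ring A] [Algebra F A] {f : FreeAlgebra F ℕ} :
    f ∈ identities F A ↔ ∀ a : ℕ → A, FreeAlgebra.lift F a f = 0 :=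
  TwoSidedIdeal.mem_mk' _ _ _ _ _ _ _

/-- A T-ideal is a two-sided ideal of the free algebra that is stable under all of its algebra
endomorphisms. -/
def IsTIdeal (I : TwoSidedIdeal (FreeAlgebra F ℕ)) : Prop :=
  ∀ φ : FreeAlgebra F ℕ →ₐ[F] FreeAlgebra F ℕ, ∀ f ∈ I, φ f ∈ I

/-- The T-ideal generated by a set of polynomials: the smallest T-ideal containing it. -/
noncomputable def tIdealSpan (Y : Set (FreeAlgebra F ℕ)) : TwoSidedIdeal (FreeAlgebra F ℕ) :=
  sInf {I | IsTIdeal F I ∧ Y ⊆ {f | f ∈ I}}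

/-- The polynomial `[x₁, x₂][x₃, x₄]⋯[x₂ₘ₋₁, x₂ₘ]`, the variables being numbered from `0`. -/
noncomputable def commutatorProduct (m : ℕ) : FreeAlgebra F ℕ :=
  ((List.range m).map fun i =>
    FreeAlgebra.ι F (2 * i) * FreeAlgebra.ι F (2 * i + 1) -
      FreeAlgebra.ι F (2 * i + 1) * FreeAlgebra.ι F (2 * i)).prod

end Identities

end QuiverPI

/-! Let `J` be the kernel of the abelianization of the free algebra `A`. Both inclusions compare
identities with `J ^ m`. Lazy paths commute with one another, so every commutator in the path
algebra lies in the span of paths of positive length. A product of `m` commutators is then spanned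
by paths of length at least `m`, and there are none (`commutatorProduct_mem_identities`).
Conversely, a longest path has `m` distinct vertices. Right multiplication by combinations of their
lazy paths and the joining arrows acts on the prefixes of the path by arbitrary `m × m` upper
bidiagonal matrices, so an identity vanishes at all of these
(`bidiagEval_eq_zero_of_mem_identities`). Expanding the first row by the letter at which row `0` is
left produces Fox derivatives. Since `F` is infinite, induction on `m` puts the identity in `J ^ m *
⊤` (`mem_abelKer_pow_of_bidiagEval`). Finally `J` is spanned by left multiples of commutators, and
all outer factors can be moved to the left, so `J ^ m * ⊤` lies in every T-ideal containing the
commutator product (`mem_of_mem_abelKer_pow`). -/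

namespace QuiverPI

open MvPolynomial (X monomial)
open scoped Pointwise

/-! ### Commutators and the kernel of the abelianization -/

section Abelianization

variable (F : Type*) [Field F]

/-- The free algebra is the smallest subspace that contains `1` and is stable under left
multiplication by the variables. -/
theorem freeAlgebra_left_induction {S : Submodule F (FreeAlgebra F ℕ)} (one : 1 ∈ S)
    (mul : ∀ i, ∀ f ∈ S, FreeAlgebra.ι F i * f ∈ S) (f : FreeAlgebra F ℕ) : f ∈ S := by
  suffices h : ∀ g ∈ S, f * g ∈ S by simpa using h 1 one
  induction f using FreeAlgebra.induction with
  | grade0 r => intro g hg; rw [← Algebra.smul_def]; exact S.smul_mem r hg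
  | grade1 i => exact mul i
  | mul a b ha hb => intro g hg; rw [mul_assoc]; exact ha _ (hb _ hg)
  | add a b ha hb => intro g hg; rw [add_mul]; exact S.add_mem (ha _ hg) (hb _ hg)

/-- The abelianization of the free algebra. -/
noncomputable def abel : FreeAlgebra F ℕ →ₐ[F] MvPolynomial ℕ F :=
  FreeAlgebra.lift F X

/-- The kernel of the abelianization, as a subspace. -/
noncomputable def abelKer : Submodule F (FreeAlgebra F ℕ) :=
  LinearMap.ker (abel F).toLinearMap

variable {F} in
theorem mem_abelKer {f : FreeAlgebra F ℕ} : f ∈ abelKer F ↔ abel F f = 0 := Iff.rfl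

@[simp]
theorem abel_ι (i : ℕ) : abel F (FreeAlgebra.ι F i) = X i := by
  simp [abel]

theorem abel_surjective : Function.Surjective (abel F) := by
  rw [← AlgHom.range_eq_top, eq_top_iff, ← MvPolynomial.adjoin_range_X, Algebra.adjoin_le_iff]
  rintro _ ⟨i, rfl⟩
  exact ⟨FreeAlgebra.ι F i, abel_ι F i⟩

/-- A linear section of the abelianization that preserves `1`. -/
theorem exists_section : ∃ s : MvPolynomial ℕ F →ₗ[F] FreeAlgebra F ℕ,
    (∀ q, abel F (s q) = q) ∧ s 1 = 1 := by
  obtain ⟨s, hs⟩ := (abel F).toLinearMap.exists_rightInverse_of_surjective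
    (LinearMap.range_eq_top.2 (abel_surjective F))
  have hs' : ∀ q, abel F (s q) = q := fun q => LinearMap.congr_fun hs q
  -- The correction has values in the kernel of `abel`, because `1 - s 1` does.
  refine ⟨s + (MvPolynomial.lcoeff F 0).smulRight (1 - s 1), fun q => ?_, ?_⟩
  · simp [hs']
  · simp

theorem top_mul_top_mul_le (N : Submodule F (FreeAlgebra F ℕ)) : ⊤ * ⊤ * N ≤ ⊤ * N :=
  mul_le_mul' le_top le_rfl

/-- The set of commutators. -/
def commutators : Set (FreeAlgebra F ℕ) :=
  {c | ∃ u v, c = u * v - v * u}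

/-- By `[u, v] a = [u, v a] - v [u, a]`, right factors can be traded for left ones. -/
theorem span_commutators_mul_top_le :
    Submodule.span F (commutators F) * ⊤ ≤ ⊤ * Submodule.span F (commutators F) := by
  rw [← Submodule.span_univ, Submodule.span_mul_span, Submodule.span_le]
  rintro _ ⟨_, ⟨u, v, rfl⟩, a, -, rfl⟩
  have h : (u * v - v * u) * a =
      1 * (u * (v * a) - v * a * u) - v * (u * a - a * u) := by
    noncomm_ring
  simp only [SetLike.mem_coe]
  rw [h]
  exact sub_mem
    (Submodule.mul_mem_mul (Submodule.subset_span trivial) (Submodule.subset_span ⟨_, _, rfl⟩))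
    (Submodule.mul_mem_mul (Submodule.subset_span trivial) (Submodule.subset_span ⟨_, _, rfl⟩))

/-- The two-sided ideal generated by the commutators: the span of their left multiples. -/
noncomputable def commutatorIdeal : TwoSidedIdeal (FreeAlgebra F ℕ) :=
  TwoSidedIdeal.mk' (⊤ * Submodule.span F (commutators F) : Submodule F (FreeAlgebra F ℕ))
    (zero_mem _) (fun hx hy => add_mem hx hy) (fun hx => neg_mem hx)
    (fun {x y} hy => by
      have h := Submodule.mul_mem_mul (Submodule.mem_top (R := F) (x := x)) hy
      rw [← mul_assoc] at h
      exact top_mul_top_mul_le F _ h)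
    (fun {x y} hx => by
      have h := Submodule.mul_mem_mul hx (Submodule.mem_top (R := F) (x := y))
      rw [mul_assoc] at h
      have h' := mul_le_mul' le_rfl (span_commutators_mul_top_le F) h
      rw [← mul_assoc] at h'
      exact top_mul_top_mul_le F _ h')

/-- The quotient by the commutator ideal is commutative, so its projection factors through `abel`.
-/
theorem abelKer_le : abelKer F ≤ ⊤ * Submodule.span F (commutators F) := by
  intro f hf
  let I := commutatorIdeal F
  let Q := I.ringCon.Quotient
  have mem : ∀ g, g ∈ I ↔ g ∈ ⊤ * Submodule.span F (commutators F) := fun g =>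
    TwoSidedIdeal.mem_mk' _ _ _ _ _ _ _
  have hcomm : ∀ a b : Q, a * b = b * a := by
    intro a b
    obtain ⟨u, rfl⟩ := I.ringCon.mk'_surjective a
    obtain ⟨v, rfl⟩ := I.ringCon.mk'_surjective b
    rw [← map_mul, ← map_mul]
    refine (RingCon.eq _).2 ((TwoSidedIdeal.rel_iff I _ _).2 ((mem _).2 ?_))
    rw [← one_mul (_ - _)]
    exact Submodule.mul_mem_mul trivial (Submodule.subset_span ⟨_, _, rfl⟩)
  let : CommRing Q := { (inferInstance : Ring Q) with mul_comm := hcomm }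
  let mk : FreeAlgebra F ℕ →ₐ[F] Q := I.ringCon.mkₐ F
  have h : (MvPolynomial.aeval fun i => mk (FreeAlgebra.ι F i)).comp (abel F) = mk := by
    ext i
    simp
  have h0 : mk f = 0 := by
    rw [← h, AlgHom.comp_apply, mem_abelKer.1 hf, map_zero]
  have h1 : I.ringCon f 0 := (RingCon.eq _).1 h0
  rw [← mem, TwoSidedIdeal.mem_iff]
  exact h1

/-- All outer factors are pushed to the left, leaving bare products of `m` commutators, which are
substitution instances of `commutatorProduct`. -/
theorem abelKer_pow_mul_top_le (m : ℕ) :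
    abelKer F ^ m * ⊤ ≤ ⊤ * Submodule.span F (commutators F) ^ m := by
  induction m with
  | zero => simp
  | succ m ih =>
    calc abelKer F ^ (m + 1) * ⊤
        ≤ abelKer F ^ m * (⊤ * Submodule.span F (commutators F)) * ⊤ := by
          rw [pow_succ]
          exact mul_le_mul' (mul_le_mul' le_rfl (abelKer_le F)) le_rfl
      _ = abelKer F ^ m * ⊤ * (Submodule.span F (commutators F) * ⊤) := by
          simp only [mul_assoc]
      _ ≤ abelKer F ^ m * ⊤ * (⊤ * Submodule.span F (commutators F)) :=
          mul_le_mul' le_rfl (span_commutators_mul_top_le F)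
      _ = abelKer F ^ m * (⊤ * ⊤) * Submodule.span F (commutators F) := by
          simp only [mul_assoc]
      _ ≤ abelKer F ^ m * ⊤ * Submodule.span F (commutators F) :=
          mul_le_mul' (mul_le_mul' le_rfl le_top) le_rfl
      _ ≤ ⊤ * Submodule.span F (commutators F) ^ m * Submodule.span F (commutators F) :=
          mul_le_mul' ih le_rfl
      _ = ⊤ * Submodule.span F (commutators F) ^ (m + 1) := by
          rw [pow_succ, mul_assoc]

theorem map_commutatorProduct {A : Type*} [Ring A] [Algebra F A] (φ : FreeAlgebra F ℕ →ₐ[F] A)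
    (m : ℕ) : φ (commutatorProduct F m) = ((List.range m).map fun i =>
      φ (FreeAlgebra.ι F (2 * i)) * φ (FreeAlgebra.ι F (2 * i + 1)) -
        φ (FreeAlgebra.ι F (2 * i + 1)) * φ (FreeAlgebra.ι F (2 * i))).prod := by
  simp [commutatorProduct, map_list_prod, Function.comp_def]

variable {F} in
theorem mem_of_mem_abelKer_pow {I : TwoSidedIdeal (FreeAlgebra F ℕ)} (hI : IsTIdeal F I) {m : ℕ}
    (hm : commutatorProduct F m ∈ I) {f : FreeAlgebra F ℕ} (hf : f ∈ abelKer F ^ m * ⊤) :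
    f ∈ I := by
  have key : ∀ c ∈ commutators F ^ m, c ∈ I := by
    intro c hc
    obtain ⟨g, rfl⟩ := Set.mem_pow.1 hc
    choose u v huv using fun i => (g i).2
    let φ : FreeAlgebra F ℕ →ₐ[F] FreeAlgebra F ℕ := FreeAlgebra.lift F fun k =>
      if h : k / 2 < m then if k % 2 = 0 then u ⟨k / 2, h⟩ else v ⟨k / 2, h⟩ else 0
    have h := hI φ _ hm
    rw [map_commutatorProduct] at h
    refine cast (congrArg (fun l => List.prod l ∈ I) ?_) h
    refine List.ext_getElem ?_ fun i hi _ => ?_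
    · simp
    have him : i < m := by simpa using hi
    have h1 : (2 * i + 1) / 2 = i := by omega
    simp [φ, him, h1, huv]
  have hf' := abelKer_pow_mul_top_le F m hf
  clear hf
  induction hf' using Submodule.mul_induction_on' with
  | mem_mul_mem a ha b hb =>
    refine I.mul_mem_left _ _ ?_
    rw [Submodule.span_pow] at hb
    induction hb using Submodule.span_induction with
    | mem c hc => exact key c hc
    | zero => exact I.zero_mem
    | add x y _ _ hx hy => exact I.add_mem hx hy
    | smul r x _ hx => rw [Algebra.smul_def]; exact I.mul_mem_left _ _ hx
  | add x _ y _ hx hy => exact I.add_mem hx hy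

end Abelianization

/-! ### Fox derivatives modulo the abelianization of prefixes -/

section Fox

variable (F : Type*) [Field F]

/-- Left multiplication by the variable `xᵢ` on pairs `(w, D w)`. -/
noncomputable def foxStep (i : ℕ) :
    Module.End F (FreeAlgebra F ℕ × ((ℕ × (ℕ →₀ ℕ)) →₀ FreeAlgebra F ℕ)) :=
  ((LinearMap.mulLeft F (FreeAlgebra.ι F i)).comp (LinearMap.fst F _ _)).prod
    ((Finsupp.lsingle (i, 0)).comp (LinearMap.fst F _ _) +
      (Finsupp.lmapDomain _ F fun p : ℕ × (ℕ →₀ ℕ) =>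
        (p.1, p.2 + Finsupp.single i 1)).comp (LinearMap.snd F _ _))

/-- The Fox derivative: the coefficient of `fox f` at `(j, μ)` collects the suffixes that remain
when a prefix of commutative image `μ` followed by the variable `xⱼ` is removed. -/
noncomputable def fox : FreeAlgebra F ℕ →ₗ[F] (ℕ × (ℕ →₀ ℕ)) →₀ FreeAlgebra F ℕ :=
  (LinearMap.snd F _ _).comp
    ((LinearMap.applyₗ (1, 0)).comp (FreeAlgebra.lift F (foxStep F)).toLinearMap)

/-- The first component carries the word itself along, so that the recursion for `fox` has access to
the suffix. -/
theorem fox_fst (f : FreeAlgebra F ℕ) :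
    (FreeAlgebra.lift F (foxStep F) f (1, 0)).1 = f := by
  let S : Submodule F (FreeAlgebra F ℕ) := LinearMap.eqLocus
    ((LinearMap.fst F _ _).comp
      ((LinearMap.applyₗ (1, 0)).comp (FreeAlgebra.lift F (foxStep F)).toLinearMap)) LinearMap.id
  refine freeAlgebra_left_induction F (S := S) ?_ ?_ f
  · simp [S]
  · intro i f hf
    have hf' : (FreeAlgebra.lift F (foxStep F) f (1, 0)).1 = f := hf
    simp [S, foxStep, hf']

@[simp]
theorem fox_one : fox F 1 = 0 := by
  simp [fox]

theorem fox_ι_mul (i : ℕ) (f : FreeAlgebra F ℕ) :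
    fox F (FreeAlgebra.ι F i * f) = Finsupp.single (i, 0) f +
      Finsupp.mapDomain (fun p => (p.1, p.2 + Finsupp.single i 1)) (fox F f) := by
  have h := fox_fst F f
  simp [fox, foxStep, h]

theorem lsum_fox_ι_mul {M : Type*} [AddCommGroup M] [Module F M]
    (h : ℕ × (ℕ →₀ ℕ) → FreeAlgebra F ℕ →ₗ[F] M) (i : ℕ) (f : FreeAlgebra F ℕ) :
    Finsupp.lsum F h (fox F (FreeAlgebra.ι F i * f)) = h (i, 0) f +
      Finsupp.lsum F (fun p => h (p.1, p.2 + Finsupp.single i 1)) (fox F f) := by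
  rw [fox_ι_mul, map_add]
  congr 1
  · simp
  · simp only [Finsupp.coe_lsum]
    rw [Finsupp.sum_mapDomain_index] <;> simp

variable {F}

/-- The sum telescopes: on a word, the terms for consecutive prefixes cancel, leaving only the empty
and the full prefix. The offset `μ` is needed for the induction, since prepending a letter shifts
every prefix. -/
theorem lsum_fox_section {s : MvPolynomial ℕ F →ₗ[F] FreeAlgebra F ℕ} (f : FreeAlgebra F ℕ)
    (μ : ℕ →₀ ℕ) :
    Finsupp.lsum F (fun p : ℕ × (ℕ →₀ ℕ) => LinearMap.mulLeft F
        (s (monomial (μ + p.2 + Finsupp.single p.1 1) 1) -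
          s (monomial (μ + p.2) 1) * FreeAlgebra.ι F p.1)) (fox F f) =
      s (monomial μ 1 * abel F f) - s (monomial μ 1) * f := by
  let h (μ : ℕ →₀ ℕ) (p : ℕ × (ℕ →₀ ℕ)) : FreeAlgebra F ℕ →ₗ[F] FreeAlgebra F ℕ :=
    LinearMap.mulLeft F (s (monomial (μ + p.2 + Finsupp.single p.1 1) 1) -
      s (monomial (μ + p.2) 1) * FreeAlgebra.ι F p.1)
  let S : Submodule F (FreeAlgebra F ℕ) := ⨅ μ : ℕ →₀ ℕ, LinearMap.eqLocus
    ((Finsupp.lsum F (h μ)).comp (fox F))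
    (s.comp ((LinearMap.mulLeft F (monomial μ 1)).comp (abel F).toLinearMap) -
      LinearMap.mulLeft F (s (monomial μ 1)))
  have mem : ∀ f, f ∈ S ↔ ∀ μ, Finsupp.lsum F (h μ) (fox F f) =
      s (monomial μ 1 * abel F f) - s (monomial μ 1) * f := fun f => by
    simp only [S, Submodule.mem_iInf]; rfl
  refine (mem f).1 (freeAlgebra_left_induction F (S := S) ?_ ?_ f) μ
  · rw [mem]
    simp
  · intro i f hf
    rw [mem] at hf ⊢
    intro μ
    have h1 : (fun p : ℕ × (ℕ →₀ ℕ) => h μ (p.1, p.2 + Finsupp.single i 1)) =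
        h (μ + Finsupp.single i 1) := by
      funext p
      simp only [h, add_assoc, add_comm, add_left_comm]
    have h2 : monomial μ (1 : F) * (X i * abel F f) =
        monomial (μ + Finsupp.single i 1) 1 * abel F f := by
      rw [← mul_assoc, MvPolynomial.X, MvPolynomial.monomial_mul, one_mul]
    rw [lsum_fox_ι_mul, h1, hf, map_mul (abel F), abel_ι, h2]
    simp only [h, LinearMap.mulLeft_apply, add_zero, sub_mul, mul_assoc]
    abel

/-- A polynomial of zero abelianization lies in the product of the kernel of the abelianization
with any subspace that contains its Fox derivatives. -/
theorem mem_abelKer_mul_of_fox {N : Submodule F (FreeAlgebra F ℕ)} {f : FreeAlgebra F ℕ}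
    (hf : abel F f = 0) (hN : ∀ p, fox F f p ∈ N) : f ∈ abelKer F * N := by
  obtain ⟨s, hs, hs1⟩ := exists_section F
  have h := lsum_fox_section (s := s) f 0
  rw [hf, mul_zero, map_zero, zero_sub] at h
  have h1 : (monomial (0 : ℕ →₀ ℕ) (1 : F)) = 1 := rfl
  rw [h1, hs1, one_mul] at h
  rw [← neg_mem_iff, ← h, Finsupp.lsum_apply, Finsupp.sum]
  -- Each left factor `s(μ xⱼ) - s(μ) xⱼ` has zero abelianization.
  refine Submodule.sum_mem _ fun p _ => Submodule.mul_mem_mul ?_ (hN p)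
  rw [mem_abelKer, map_sub, map_mul, hs, hs, abel_ι, MvPolynomial.X, MvPolynomial.monomial_mul,
    one_mul, sub_self]

end Fox

/-! ### The generic triangular representation -/

section Triangular

variable {F : Type*} [Field F]

/-- The bidiagonal operator `g ↦ (k ↦ t k * g k + y k * g (k + 1))`. -/
def bidiag (t y : ℕ → F) : Module.End F (ℕ → F) where
  toFun g k := t k * g k + y k * g (k + 1)
  map_add' g h := by funext k; simp; ring
  map_smul' c g := by funext k; simp; ring

/-- The evaluation of noncommutative polynomials at bidiagonal operators. -/
noncomputable def bidiagEval (t y : ℕ → ℕ → F) : FreeAlgebra F ℕ →ₐ[F] Module.End F (ℕ → F) :=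
  FreeAlgebra.lift F fun j => bidiag (fun k => t k j) (fun k => y k j)

theorem bidiagEval_ι_mul (t y : ℕ → ℕ → F) (i : ℕ) (f : FreeAlgebra F ℕ) (g : ℕ → F) (k : ℕ) :
    bidiagEval t y (FreeAlgebra.ι F i * f) g k =
      t k i * bidiagEval t y f g k + y k i * bidiagEval t y f g (k + 1) := by
  simp [bidiagEval, bidiag]

/-- The value at `k` as a linear functional of the polynomial. -/
noncomputable def bidiagEvalAt (t y : ℕ → ℕ → F) (g : ℕ → F) (k : ℕ) : FreeAlgebra F ℕ →ₗ[F] F :=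
  (LinearMap.proj k).comp ((LinearMap.applyₗ g).comp (bidiagEval t y).toLinearMap)

/-- The operators are upper triangular, so rows from `1` on never see row `0`. -/
theorem bidiagEval_succ (t y : ℕ → ℕ → F) (f : FreeAlgebra F ℕ) (g : ℕ → F) (k : ℕ) :
    bidiagEval t y f g (k + 1) =
      bidiagEval (fun k => t (k + 1)) (fun k => y (k + 1)) f (fun k => g (k + 1)) k := by
  let S : Submodule F (FreeAlgebra F ℕ) := ⨅ k : ℕ, LinearMap.eqLocus
    (bidiagEvalAt t y g (k + 1))
    (bidiagEvalAt (fun k => t (k + 1)) (fun k => y (k + 1)) (fun k => g (k + 1)) k)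
  have mem : ∀ f, f ∈ S ↔ ∀ k, bidiagEval t y f g (k + 1) =
      bidiagEval (fun k => t (k + 1)) (fun k => y (k + 1)) f (fun k => g (k + 1)) k := fun f => by
    simp only [S, Submodule.mem_iInf]; rfl
  refine (mem f).1 (freeAlgebra_left_induction F (S := S) ?_ ?_ f) k
  · simp [mem]
  · intro i f hf
    rw [mem] at hf ⊢
    intro k
    rw [bidiagEval_ι_mul, bidiagEval_ι_mul, hf, hf]

/-- A word either stays in row `0`, contributing its abelianization at `t 0`, or leaves it at a
letter `xⱼ` after a prefix `μ`; the remaining suffix then acts from row `1`. -/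
theorem bidiagEval_zero (t y : ℕ → ℕ → F) (f : FreeAlgebra F ℕ) (g : ℕ → F) :
    bidiagEval t y f g 0 = MvPolynomial.eval (t 0) (abel F f) * g 0 +
      Finsupp.lsum F (fun p : ℕ × (ℕ →₀ ℕ) =>
        (MvPolynomial.eval (t 0) (monomial p.2 1) * y 0 p.1) • bidiagEvalAt t y g 1)
        (fox F f) := by
  let h (μ : ℕ →₀ ℕ) (p : ℕ × (ℕ →₀ ℕ)) : FreeAlgebra F ℕ →ₗ[F] F :=
    (MvPolynomial.eval (t 0) (monomial (μ + p.2) 1) * y 0 p.1) • bidiagEvalAt t y g 1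
  let S : Submodule F (FreeAlgebra F ℕ) := ⨅ μ : ℕ →₀ ℕ, LinearMap.eqLocus
    (MvPolynomial.eval (t 0) (monomial μ 1) • bidiagEvalAt t y g 0)
    ((MvPolynomial.eval (t 0) (monomial μ 1) * g 0) •
      ((MvPolynomial.aeval (t 0)).comp (abel F)).toLinearMap +
      (Finsupp.lsum F (h μ)).comp (fox F))
  have mem : ∀ f, f ∈ S ↔ ∀ μ, MvPolynomial.eval (t 0) (monomial μ 1) * bidiagEval t y f g 0 =
      MvPolynomial.eval (t 0) (monomial μ 1) * g 0 * MvPolynomial.eval (t 0) (abel F f) +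
        Finsupp.lsum F (h μ) (fox F f) := fun f => by
    simp only [S, Submodule.mem_iInf]; rfl
  have key := (mem f).1 (freeAlgebra_left_induction F (S := S) ?_ ?_ f) 0
  · simpa [h, mul_comm] using key
  · simp [mem]
  · intro i f hf
    rw [mem] at hf ⊢
    intro μ
    have h1 : (fun p : ℕ × (ℕ →₀ ℕ) => h μ (p.1, p.2 + Finsupp.single i 1)) =
        h (μ + Finsupp.single i 1) := by
      funext p
      simp only [h, add_comm, add_left_comm]
    have h2 : MvPolynomial.eval (t 0) (monomial (μ + Finsupp.single i 1) (1 : F)) =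
        MvPolynomial.eval (t 0) (monomial μ 1) * t 0 i := by
      rw [← one_mul (1 : F), ← MvPolynomial.monomial_mul, map_mul, one_mul, ← MvPolynomial.X,
        MvPolynomial.eval_X]
    have h3 := hf (μ + Finsupp.single i 1)
    rw [h2] at h3
    have h4 : h μ (i, 0) f =
        MvPolynomial.eval (t 0) (monomial μ 1) * y 0 i * bidiagEval t y f g 1 := by
      simp only [h, add_zero]; rfl
    rw [lsum_fox_ι_mul, h1, bidiagEval_ι_mul, map_mul, abel_ι, map_mul, MvPolynomial.eval_X, h4]
    linear_combination h3

/-- Prepend a value to a sequence. -/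
def seqCons {α : Type*} (a : α) (s : ℕ → α) : ℕ → α
  | 0 => a
  | k + 1 => s k

/-- The sum is linear in `y` and polynomial in `t`; taking `y` to be a unit vector isolates one
letter, and a polynomial vanishing on an infinite field is zero. -/
theorem eq_zero_of_forall_sum_eq_zero [Infinite F] {c : (ℕ × (ℕ →₀ ℕ)) →₀ F}
    (hc : ∀ t y : ℕ → F,
      c.sum (fun p a => MvPolynomial.eval t (monomial p.2 1) * y p.1 * a) = 0) : c = 0 := by
  classical
  ext ⟨j, μ⟩
  let q : MvPolynomial ℕ F := ∑ p ∈ c.support, if p.1 = j then monomial p.2 (c p) else 0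
  have hq : q = 0 := by
    refine MvPolynomial.funext fun t => ?_
    have h := hc t (Pi.single j 1)
    rw [map_zero, ← h, Finsupp.sum, map_sum]
    refine Finset.sum_congr rfl fun p _ => ?_
    by_cases hp : p.1 = j
    · simp [hp, MvPolynomial.eval_monomial, mul_comm]
    · simp [hp]
  have h : q.coeff μ = c (j, μ) := by
    simp only [q, MvPolynomial.coeff_sum, apply_ite (MvPolynomial.coeff μ),
      MvPolynomial.coeff_monomial, MvPolynomial.coeff_zero]
    rw [Finset.sum_eq_single (j, μ)]
    · simp
    · rintro ⟨j', μ'⟩ _ hne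
      by_cases h1 : j' = j
      · have h2 : μ' ≠ μ := fun h2 => hne (by rw [h1, h2])
        simp [h2]
      · simp [h1]
    · simp
  rw [← h, hq]
  simp

/-- A polynomial whose first row vanishes at all `m × m` upper bidiagonal matrices lies in the
`m`-th power of the kernel of the abelianization. -/
theorem mem_abelKer_pow_of_bidiagEval [Infinite F] (m : ℕ) (f : FreeAlgebra F ℕ)
    (hf : ∀ (t y : ℕ → ℕ → F) (g : ℕ → F), (∀ k, m ≤ k → g k = 0) →
      bidiagEval t y f g 0 = 0) : f ∈ abelKer F ^ m * ⊤ := by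
  induction m generalizing f with
  | zero =>
    rw [pow_zero, one_mul]
    trivial
  | succ m ih =>
    rw [pow_succ', mul_assoc]
    refine mem_abelKer_mul_of_fox ?_ fun p => ih _ fun t' y' g' hg' => ?_
    · refine MvPolynomial.funext fun t => ?_
      -- With `y = 0` only the diagonal term survives.
      have h := hf (fun _ => t) 0 (Pi.single 0 1) fun k hk => by
        rw [Pi.single_apply, if_neg (by omega)]
      rw [bidiagEval_zero, Finsupp.lsum_apply] at h
      simpa [Finsupp.sum] using h
    · let c : (ℕ × (ℕ →₀ ℕ)) →₀ F :=
        (fox F f).mapRange (bidiagEvalAt t' y' g' 0) (map_zero _)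
      have hc : c = 0 := by
        refine eq_zero_of_forall_sum_eq_zero fun t y => ?_
        -- The leading `0` of the vector kills the diagonal term, leaving only the Fox terms.
        have h := hf (seqCons t t') (seqCons y y') (seqCons 0 g') fun k hk => by
          obtain ⟨k, rfl⟩ : ∃ l, k = l + 1 := ⟨k - 1, by omega⟩
          exact hg' k (by omega)
        rw [bidiagEval_zero] at h
        rw [← h, Finsupp.sum_mapRange_index (by simp)]
        simp only [seqCons, mul_zero, zero_add, Finsupp.coe_lsum]
        refine Finsupp.sum_congr fun p _ => ?_
        have h1 : bidiagEvalAt (seqCons t t') (seqCons y y') (seqCons 0 g') 1 (fox F f p) =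
            bidiagEvalAt t' y' g' 0 (fox F f p) := bidiagEval_succ _ _ _ _ 0
        rw [LinearMap.smul_apply, h1, smul_eq_mul]
      exact DFunLike.congr_fun hc p

end Triangular

/-! ### Paths in acyclic quivers -/

section Paths

variable {V : Type*} [Quiver V]

theorem exists_vertex_sequence {a b : V} (p : Quiver.Path a b) :
    ∃ v : ℕ → V, v p.length = b ∧ ∀ i < p.length, Nonempty (v i ⟶ v (i + 1)) := by
  induction p with
  | nil => exact ⟨fun _ => a, rfl, by simp⟩
  | @cons b c p e ih =>
    obtain ⟨v, hv, hs⟩ := ih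
    refine ⟨fun i => if i ≤ p.length then v i else c, by simp, fun i hi => ?_⟩
    rw [Quiver.Path.length_cons] at hi
    have h1 : i ≤ p.length := by omega
    rcases h1.lt_or_eq with h2 | h2
    · have h3 : i + 1 ≤ p.length := h2
      simpa [h1, h3] using hs i h2
    · subst h2
      simpa [hv] using ⟨e⟩

theorem exists_path_of_vertex_sequence {n : ℕ} {v : ℕ → V}
    (hs : ∀ i < n, Nonempty (v i ⟶ v (i + 1))) (i d : ℕ) (h : i + d ≤ n) :
    ∃ p : Quiver.Path (v i) (v (i + d)), p.length = d := by
  induction d with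
  | zero => exact ⟨Quiver.Path.nil, rfl⟩
  | succ d ih =>
    obtain ⟨p, hp⟩ := ih (by omega)
    obtain ⟨e⟩ := hs (i + d) (by omega)
    exact ⟨p.cons e, by rw [Quiver.Path.length_cons, hp]⟩

/-- A repeated vertex would close an oriented cycle. -/
theorem IsAcyclic.injOn_vertex_sequence (hQ : IsAcyclic V) {n : ℕ} {v : ℕ → V}
    (hs : ∀ i < n, Nonempty (v i ⟶ v (i + 1))) : Set.InjOn v (Set.Iic n) := by
  have key : ∀ i j, i < j → j ≤ n → v i ≠ v j := by
    intro i j hij hj h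
    obtain ⟨d, rfl⟩ : ∃ d, j = i + d := ⟨j - i, by omega⟩
    obtain ⟨p, hp⟩ := exists_path_of_vertex_sequence hs i d hj
    have h0 : ∀ (b : V) (q : Quiver.Path (v i) b), v i = b → q.length = 0 := by
      rintro _ q rfl
      exact hQ _ q
    have := h0 _ p h
    omega
  intro i hi j hj h
  by_contra hne
  rcases lt_or_gt_of_ne hne with h1 | h1
  · exact key i j h1 hj h
  · exact key j i h1 hi h.symm

theorem IsAcyclic.length_lt_card [Fintype V] (hQ : IsAcyclic V) {a b : V}
    (p : Quiver.Path a b) : p.length < Fintype.card V := by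
  obtain ⟨v, -, hs⟩ := exists_vertex_sequence p
  have h := Fintype.card_le_of_injective (fun i : Fin (p.length + 1) => v i) fun i j hij =>
    Fin.ext (hQ.injOn_vertex_sequence hs (by simp; omega) (by simp; omega) hij)
  simpa using h

theorem IsAcyclic.exists_isGreatest_pathLengths [Fintype V] [Nonempty V] (hQ : IsAcyclic V) :
    ∃ n, IsGreatest (pathLengths V) n := by
  classical
  have hb : ∀ k ∈ pathLengths V, k ≤ Fintype.card V := by
    rintro _ ⟨p, rfl⟩
    exact (hQ.length_lt_card p.path).le
  have hne : (pathLengths V).Nonempty :=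
    ⟨0, ⟨Classical.arbitrary V, _, Quiver.Path.nil⟩, rfl⟩
  exact ⟨sSup (pathLengths V), Nat.sSup_mem hne ⟨_, hb⟩,
    fun k hk => le_csSup ⟨_, hb⟩ hk⟩

end Paths

/-! ### Identities of path algebras -/

section PathAlgebraIdentities

/-! ### Length filtration and products of commutators -/

namespace PathAlgebra

variable (F : Type*) [Field F] {V : Type*} [Quiver V]

/-- The span of the paths of length at least `k`. -/
noncomputable def lengthFiltration (V : Type*) [Quiver V] (k : ℕ) :
    Submodule F (PathAlgebra F V) :=
  Submodule.span F {x | ∃ p : QPath V, k ≤ p.path.length ∧ x = ofPath F p}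

theorem span_range_ofPath : Submodule.span F (Set.range (ofPath F (V := V))) = ⊤ :=
  (basis F V).span_eq

theorem pathMul_mem_lengthFiltration (p q : QPath V) {k : ℕ}
    (h : k ≤ p.path.length + q.path.length) : pathMul F p q ∈ lengthFiltration F V k := by
  obtain ⟨a, b, p⟩ := p
  obtain ⟨b', c, q⟩ := q
  by_cases hb : b' = b
  · subst hb
    rw [pathMul_comp]
    exact Submodule.subset_span ⟨_, by simpa using h, rfl⟩
  · rw [pathMul_of_ne F (by exact hb)]
    exact zero_mem _

variable [Fintype V]

theorem ofPath_mul_ofPath (p q : QPath V) : ofPath F p * ofPath F q = pathMul F p q :=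
  mulLin_ofPath F p q

theorem mul_mem_lengthFiltration {k l : ℕ} {x y : PathAlgebra F V}
    (hx : x ∈ lengthFiltration F V k) (hy : y ∈ lengthFiltration F V l) :
    x * y ∈ lengthFiltration F V (k + l) := by
  have h : lengthFiltration F V k * lengthFiltration F V l ≤ lengthFiltration F V (k + l) := by
    unfold lengthFiltration
    rw [Submodule.span_mul_span, Submodule.span_le]
    rintro _ ⟨_, ⟨p, hp, rfl⟩, _, ⟨q, hq, rfl⟩, rfl⟩
    change ofPath F p * ofPath F q ∈ _
    rw [ofPath_mul_ofPath]
    exact pathMul_mem_lengthFiltration F p q (by omega)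
  exact h (Submodule.mul_mem_mul hx hy)

/-- Two paths whose lengths sum to zero are lazy, and lazy paths commute. -/
theorem commutator_mem_lengthFiltration (x y : PathAlgebra F V) :
    x * y - y * x ∈ lengthFiltration F V 1 := by
  have hx : x ∈ Submodule.span F (Set.range (ofPath F (V := V))) := by
    rw [span_range_ofPath]; trivial
  have hy : y ∈ Submodule.span F (Set.range (ofPath F (V := V))) := by
    rw [span_range_ofPath]; trivial
  induction hx, hy using Submodule.span_induction₂ with
  | mem_mem x y hx hy =>
    obtain ⟨p, rfl⟩ := hx
    obtain ⟨q, rfl⟩ := hy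
    rw [ofPath_mul_ofPath, ofPath_mul_ofPath]
    by_cases h : 1 ≤ p.path.length + q.path.length
    · exact sub_mem (pathMul_mem_lengthFiltration F p q h)
        (pathMul_mem_lengthFiltration F q p (by omega))
    · obtain ⟨a, b, p⟩ := p
      obtain ⟨c, d, q⟩ := q
      have hp : p.length = 0 := by simp at h; omega
      have hq : q.length = 0 := by simp at h; omega
      obtain rfl := Quiver.Path.eq_of_length_zero p hp
      obtain rfl := Quiver.Path.eq_of_length_zero q hq
      obtain rfl := Quiver.Path.eq_nil_of_length_zero p hp
      obtain rfl := Quiver.Path.eq_nil_of_length_zero q hq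
      by_cases hac : c = a
      · subst hac
        rw [sub_self]
        exact zero_mem _
      · rw [pathMul_of_ne F (by exact hac), pathMul_of_ne F (by exact fun h => hac h.symm),
          sub_self]
        exact zero_mem _
  | zero_left y _ => simp
  | zero_right x _ => simp
  | add_left x y z _ _ _ h1 h2 =>
    convert add_mem h1 h2 using 1
    noncomm_ring
  | add_right x y z _ _ _ h1 h2 =>
    convert add_mem h1 h2 using 1
    noncomm_ring
  | smul_left r x y _ _ h =>
    rw [smul_mul_assoc, mul_smul_comm, ← smul_sub]
    exact Submodule.smul_mem _ r h
  | smul_right r x y _ _ h =>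
    rw [smul_mul_assoc, mul_smul_comm, ← smul_sub]
    exact Submodule.smul_mem _ r h

theorem prod_mem_lengthFiltration (l : List (PathAlgebra F V))
    (h : ∀ x ∈ l, x ∈ lengthFiltration F V 1) : l.prod ∈ lengthFiltration F V l.length := by
  induction l with
  | nil =>
    rw [List.prod_nil]
    exact Submodule.sum_mem _ fun a _ => Submodule.subset_span ⟨_, Nat.zero_le _, rfl⟩
  | cons x l ih =>
    rw [List.prod_cons, List.length_cons, add_comm]
    exact mul_mem_lengthFiltration F (h x (by simp)) (ih fun y hy => h y (by simp [hy]))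

theorem commutatorProduct_mem_identities {m : ℕ} (hm : ∀ p : QPath V, p.path.length < m) :
    commutatorProduct F m ∈ identities F (PathAlgebra F V) := by
  rw [mem_identities]
  intro a
  rw [map_commutatorProduct]
  have h := prod_mem_lengthFiltration F ((List.range m).map fun i =>
      FreeAlgebra.lift F a (FreeAlgebra.ι F (2 * i)) *
        FreeAlgebra.lift F a (FreeAlgebra.ι F (2 * i + 1)) -
      FreeAlgebra.lift F a (FreeAlgebra.ι F (2 * i + 1)) *
        FreeAlgebra.lift F a (FreeAlgebra.ι F (2 * i))) fun x hx => by
    obtain ⟨i, -, rfl⟩ := List.mem_map.1 hx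
    exact commutator_mem_lengthFiltration F _ _
  have h0 : lengthFiltration F V m = ⊥ := by
    rw [lengthFiltration, Submodule.span_eq_bot]
    rintro _ ⟨p, hp, rfl⟩
    exact absurd hp (not_le.2 (hm p))
  rw [List.length_map, List.length_range, h0] at h
  exact (Submodule.mem_bot F).1 h

end PathAlgebra

variable {F : Type*} [Field F]

theorem isTIdeal_identities (A : Type*) [Ring A] [Algebra F A] :
    IsTIdeal F (identities F A) := by
  intro φ f hf
  rw [mem_identities] at hf ⊢
  intro a
  have h : (FreeAlgebra.lift F a).comp φ =
      FreeAlgebra.lift F fun i => FreeAlgebra.lift F a (φ (FreeAlgebra.ι F i)) := by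
    ext i
    simp
  rw [← AlgHom.comp_apply, h]
  exact hf _

/-- Substitutions acting on a sequence of elements by bidiagonal matrices realize the generic
bidiagonal representation. -/
theorem bidiagEval_eq_of_mul {A : Type*} [Ring A] [Algebra F A] {t y : ℕ → ℕ → F} {Y : ℕ → A}
    {p : ℕ → A} (hp : ∀ k j, p k * Y j = t k j • p k + y k j • p (k + 1))
    (f : FreeAlgebra F ℕ) (l : A →ₗ[F] F) :
    bidiagEval t y f (fun k => l (p k)) = fun k => l (p k * FreeAlgebra.lift F Y f) := by
  induction f using FreeAlgebra.induction generalizing l with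
  | grade0 r =>
    funext k
    rw [AlgHom.commutes, AlgHom.commutes, ← Algebra.commutes, ← Algebra.smul_def, map_smul]
    rfl
  | grade1 j =>
    funext k
    simp [bidiagEval, bidiag, hp]
  | mul a b ha hb =>
    rw [map_mul, Module.End.mul_apply, hb]
    -- Right multiplication by the value of `b` is absorbed into the functional, hence the induction
    -- over all `l`.
    have h := ha (l.comp (LinearMap.mulRight F (FreeAlgebra.lift F Y b)))
    simpa [mul_assoc] using h
  | add a b ha hb =>
    rw [map_add, LinearMap.add_apply, ha, hb]
    funext k
    simp [mul_add]

/-! ### Bidiagonal matrices from a path -/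

namespace PathAlgebra

variable {V : Type*} [Quiver V] [Fintype V]

theorem bidiagEval_eq_zero_of_mem_identities (hQ : IsAcyclic V) {n : ℕ} {v : ℕ → V}
    (hs : ∀ i < n, Nonempty (v i ⟶ v (i + 1))) {f : FreeAlgebra F ℕ}
    (hf : f ∈ identities F (PathAlgebra F V)) (t y : ℕ → ℕ → F) {g : ℕ → F}
    (hg : ∀ k, n + 1 ≤ k → g k = 0) : bidiagEval t y f g 0 = 0 := by
  classical
  have hinj := hQ.injOn_vertex_sequence hs
  let e (i : {i // i < n}) : v i ⟶ v (i + 1) := Classical.choice (hs i i.2)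
  -- The value `0` beyond the path makes the prefixes `p k` vanish for `k > n`.
  let arrow (i : ℕ) : PathAlgebra F V :=
    if h : i < n then ofPath F ⟨v i, v (i + 1), (e ⟨i, h⟩).toPath⟩ else 0
  let idem (i : ℕ) : PathAlgebra F V := ofPath F ⟨v i, v i, Quiver.Path.nil⟩
  let p (k : ℕ) : PathAlgebra F V := Nat.rec (idem 0) (fun i x => x * arrow i) k
  have p_succ : ∀ k, p (k + 1) = p k * arrow k := fun k => rfl
  have p_eq : ∀ k ≤ n, ∃ q : Quiver.Path (v 0) (v k),
      q.length = k ∧ p k = ofPath F ⟨v 0, v k, q⟩ := by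
    intro k
    induction k with
    | zero => exact fun _ => ⟨Quiver.Path.nil, rfl, rfl⟩
    | succ k ih =>
      intro hk
      obtain ⟨q, hq, hpq⟩ := ih (by omega)
      have hk' : k < n := hk
      refine ⟨q.comp (e ⟨k, hk'⟩).toPath, by simp [hq], ?_⟩
      rw [p_succ, hpq]
      simp only [arrow, hk', dif_pos]
      rw [ofPath_mul_ofPath, pathMul_comp]
  have p_zero : ∀ k, n + 1 ≤ k → p k = 0 := by
    intro k hk
    induction k, hk using Nat.le_induction with
    | base => simp [p_succ, arrow]
    | succ k _ ih => rw [p_succ, ih, zero_mul]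
  have p_idem : ∀ k ≤ n, ∀ i ≤ n, p k * idem i = if i = k then p k else 0 := by
    intro k hk i hi
    obtain ⟨q, -, hq⟩ := p_eq k hk
    rw [hq, ofPath_mul_ofPath]
    split_ifs with h
    · subst h
      rw [pathMul_comp, Quiver.Path.comp_nil]
    -- Distinctness of the vertices makes the lazy paths separate the prefixes.
    · exact pathMul_of_ne F fun h' => h (hinj hi hk h')
  have p_arrow : ∀ k ≤ n, ∀ i < n, p k * arrow i = if i = k then p (k + 1) else 0 := by
    intro k hk i hi
    split_ifs with h
    · subst h
      rfl
    · obtain ⟨q, -, hq⟩ := p_eq k hk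
      simp only [hq, arrow, hi, dif_pos]
      rw [ofPath_mul_ofPath]
      exact pathMul_of_ne F fun h' => h (hinj hi.le hk h')
  let Y (j : ℕ) : PathAlgebra F V :=
    ∑ i ∈ Finset.range (n + 1), t i j • idem i + ∑ i ∈ Finset.range n, y i j • arrow i
  have hp : ∀ k j, p k * Y j = t k j • p k + y k j • p (k + 1) := by
    intro k j
    by_cases hk : k ≤ n
    · have h1 : ∑ i ∈ Finset.range (n + 1), p k * (t i j • idem i) = t k j • p k := by
        rw [Finset.sum_eq_single k]
        · rw [mul_smul_comm, p_idem k hk k hk, if_pos rfl]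
        · intro i hi hik
          rw [mul_smul_comm, p_idem k hk i (by simp at hi; omega), if_neg hik, smul_zero]
        · intro h
          simp at h
          omega
      have h2 : ∑ i ∈ Finset.range n, p k * (y i j • arrow i) = y k j • p (k + 1) := by
        rw [Finset.sum_eq_single k]
        · rw [mul_smul_comm, p_succ]
        · intro i hi hik
          rw [mul_smul_comm, p_arrow k hk i (by simpa using hi), if_neg hik, smul_zero]
        -- Here `k = n`: the sum has no such term, and `p (n + 1) = 0`.
        · intro h
          simp at h
          rw [mul_smul_comm, ← p_succ, p_zero (k + 1) (by omega), smul_zero]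
      rw [mul_add, Finset.mul_sum, Finset.mul_sum, h1, h2]
    · rw [p_zero k (by omega), p_zero (k + 1) (by omega)]
      simp
  -- The prefix `p k` has length `k`, so this functional realizes any prescribed vector `g`.
  let l : PathAlgebra F V →ₗ[F] F := (basis F V).constr F fun q => g q.path.length
  have hl : ∀ k, l (p k) = g k := by
    intro k
    by_cases hk : k ≤ n
    · obtain ⟨q, hq, hpq⟩ := p_eq k hk
      rw [hpq, ← basis_apply, Module.Basis.constr_basis, hq]
    · rw [p_zero k (by omega), hg k (by omega), map_zero]
  have h := congrFun (bidiagEval_eq_of_mul hp f l) 0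
  simp only [hl] at h
  rw [h, (mem_identities F).1 hf Y, mul_zero, map_zero]

end PathAlgebra

end PathAlgebraIdentities

end QuiverPI

theorem theorem7p1 {F : Type*} [Field F] [CharZero F]
    {V : Type*} [Quiver V] [Fintype V] [Nonempty V] [∀ a b : V, Finite (a ⟶ b)]
    (hQ : QuiverPI.IsAcyclic V) :
    ∃ m : ℕ, 1 ≤ m ∧ IsGreatest (QuiverPI.pathLengths V) (m - 1) ∧
      QuiverPI.identities F (QuiverPI.PathAlgebra F V) =
        QuiverPI.tIdealSpan F {QuiverPI.commutatorProduct F m} := by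
  obtain ⟨n, hn⟩ := hQ.exists_isGreatest_pathLengths
  refine ⟨n + 1, by omega, hn, le_antisymm ?_ ?_⟩
  · refine le_sInf ?_
    rintro I ⟨hI, hmem⟩ f hf
    obtain ⟨p, hp⟩ := hn.1
    obtain ⟨v, -, hs⟩ := QuiverPI.exists_vertex_sequence p.path
    rw [hp] at hs
    exact QuiverPI.mem_of_mem_abelKer_pow hI (hmem rfl)
      (QuiverPI.mem_abelKer_pow_of_bidiagEval (n + 1) f fun t y g hg =>
        QuiverPI.PathAlgebra.bidiagEval_eq_zero_of_mem_identities hQ hs hf t y hg)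
  · refine sInf_le ⟨QuiverPI.isTIdeal_identities _, ?_⟩
    rintro _ rfl
    exact QuiverPI.PathAlgebra.commutatorProduct_mem_identities F fun p =>
      Nat.lt_succ_of_le (hn.2 ⟨p, rfl⟩)
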